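/- Let $\mathcal X\subset\mathbb R^{d_x}$ and $\mathcal Y\subset\mathbb R^{d_y}$ be finite nonempty sets contained in the Euclidean unit balls, let $A\in\mathbb R^{d_x\times d_y}$ have spectral norm $\|A\|_2\le 1$, let $u(x,y)=\langle x,Ay\rangle$, and let $v^\star=\max_{x\in\mathcal X}\min_{y\in\mathcal Y}u(x,y)$. In each round $t=1,2,\dots$ a learner chooses $x_t\in\mathcal X$ and an adaptive adversary chooses $y_t\in\mathcal Y$ (possibly depending on the whole history and on private randomness); then a reward $r_t=u(x_t,y_t)+\varepsilon_t\in[-1,1]$ is drawn, where the conditional mean of $\varepsilon_t$ given $x_1,y_1,r_1,\dots,x_{t-1},y_{t-1},r_{t-1},x_t,y_t$ is $0$. The learner observes $r_t$ and $y_t$ (informed feedback), but does not know $A$. Her regret is the pure-strategy maximin regret $\mathrm{PSMR}_T=\mathbb E\big[\sum_{t=1}^T(v^\star-u(x_t,y_t))\big]$. For $\lambda>0$ and multipliers $\beta_1,\beta_2,\dots>0$ the algorithm PureLinUCB sets $V_0=\lambda I_{d_xd_y}$, $b_0=0\in\mathbb R^{d_xd_y}$ and, in each round $t\ge 1$, with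 $\hat A_t\in\mathbb R^{d_x\times d_y}$ the matrix such that $\mathrm{vec}(\hat A_t)=V_{t-1}^{-1}b_{t-1}$, and $$U_t(x,y)=\langle x,\hat A_t y\rangle+\beta_t\sqrt{\mathrm{vec}(xy^\top)^\top V_{t-1}^{-1}\,\mathrm{vec}(xy^\top)},$$ plays some $x_t\in\arg\max_{x\in\mathcal X}\min_{y\in\mathcal Y}U_t(x,y)$ (ties broken arbitrarily), and then sets $a_t=\mathrm{vec}(x_ty_t^\top)$, $V_t=V_{t-1}+a_ta_t^\top$ and $b_t=b_{t-1}+r_ta_t$. Theorem. There is an absolute constant $C>0$ (in particular independent of $d_x,d_y,|\mathcal X|,|\mathcal Y|,A,T$, the noise and the adversary) such that for every such game, every adaptive adversary and every $T\ge 2$, PureLinUCB with $\lambda=1$, $\delta=1/T$ and $$\beta_t=\sqrt{\lambda d_xd_y}+\sqrt{2\log\tfrac1\delta+d_xd_y\log\Big(1+\frac{t}{d_xd_y\lambda}\Big)}$$ satisfies simultaneously $$\mathrm{PSMR}_T\le C\,d_xd_y\sqrt T\,\log T$$ and, for every $\Delta^{\mathrm{Lin}}>0$ such that $v^\star-u(x,y)\in(-\infty,0]\cup[\Delta^{\mathrm{Lin}},\infty)$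 for all $(x,y)\in\mathcal X\times\mathcal Y$, $$\mathrm{PSMR}_T\le \frac{C}{\Delta^{\mathrm{Lin}}}\,d_x^2d_y^2\log^2T .$$ -/

import Mathlib

open MeasureTheory
open scoped Matrix

noncomputable section

/-- A bilinear game: finite nonempty action sets in the Euclidean unit balls of `ℝ^dx` and `ℝ^dy`
and a `dx × dy` matrix whose spectral norm (the operator norm between Euclidean spaces) is at
most `1`. -/
structure BilinearGame (dx dy : ℕ) where
  X : Finset (EuclideanSpace ℝ (Fin dx))
  Y : Finset (EuclideanSpace ℝ (Fin dy))
  X_nonempty : X.Nonempty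
  Y_nonempty : Y.Nonempty
  norm_X_le : ∀ x ∈ X, ‖x‖ ≤ 1
  norm_Y_le : ∀ y ∈ Y, ‖y‖ ≤ 1
  A : Matrix (Fin dx) (Fin dy) ℝ
  norm_A_le : ‖LinearMap.toContinuousLinearMap (Matrix.toEuclideanLin A)‖ ≤ 1

namespace BilinearGame

variable {dx dy : ℕ}

/-- The bilinear utility `u(x, y) = ⟨x, A y⟩`. -/
def u (G : BilinearGame dx dy) (x : EuclideanSpace ℝ (Fin dx)) (y : EuclideanSpace ℝ (Fin dy)) :
    ℝ :=
  x.ofLp ⬝ᵥ (G.A *ᵥ y.ofLp)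

/-- The pure-strategy maximin value `max_{x ∈ X} min_{y ∈ Y} u(x, y)`. -/
def maximinValue (G : BilinearGame dx dy) : ℝ :=
  G.X.sup' G.X_nonempty fun x => G.Y.inf' G.Y_nonempty fun y => G.u x y

/-- `Δ > 0` is a valid gap parameter: `v⋆ - u(x, y) ∈ (-∞, 0] ∪ [Δ, ∞)` for all action pairs. -/
def IsGap (G : BilinearGame dx dy) (Δ : ℝ) : Prop :=
  0 < Δ ∧ ∀ x ∈ G.X, ∀ y ∈ G.Y, G.maximinValue - G.u x y ∈ Set.Iic 0 ∪ Set.Ici Δ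

end BilinearGame

/-- A (random) repeated play of the game, in rounds `t = 1, 2, …` (values at `t = 0` are ignored).

`x t`, `y t`, `r t` are the learner's action, the adversary's action and the noisy reward of
round `t`. There is no restriction on how `y t` is generated: it may depend arbitrarily on the
past actions and rewards and on private randomness, i.e. the adversary is adaptive. What makes
the play causal is the noise condition: given the history and the actions chosen in round `t`,
the noise `r t - u (x t) (y t)` has conditional mean zero. -/
structure RepeatedPlay {dx dy : ℕ} (G : BilinearGame dx dy) {Ω : Type*} [MeasurableSpace Ω]
    (μ : Measure Ω) where
  x : ℕ → Ω → EuclideanSpace ℝ (Fin dx)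
  y : ℕ → Ω → EuclideanSpace ℝ (Fin dy)
  r : ℕ → Ω → ℝ
  measurable_x : ∀ t, 1 ≤ t → Measurable (x t)
  measurable_y : ∀ t, 1 ≤ t → Measurable (y t)
  measurable_r : ∀ t, 1 ≤ t → Measurable (r t)
  x_mem : ∀ t, 1 ≤ t → ∀ ω, x t ω ∈ G.X
  y_mem : ∀ t, 1 ≤ t → ∀ ω, y t ω ∈ G.Y
  r_mem : ∀ t, 1 ≤ t → ∀ᵐ ω ∂μ, r t ω ∈ Set.Icc (-1 : ℝ) 1
  /-- The conditioning σ-algebra is generated by `x 1, …, x t`, `y 1, …, y t` and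
  `r 1, …, r (t - 1)`. -/
  noise : ∀ t, 1 ≤ t →
    μ[fun ω => r t ω - G.u (x t ω) (y t ω) |
      (⨆ s ∈ Finset.Icc 1 t, (MeasurableSpace.comap (x s) inferInstance ⊔
          MeasurableSpace.comap (y s) inferInstance)) ⊔
        ⨆ s ∈ Finset.Ico 1 t, MeasurableSpace.comap (r s) inferInstance] =ᵐ[μ] 0

/-- Pure-strategy maximin regret `E[∑_{t=1}^T (v⋆ - u(x_t, y_t))]`. -/
def RepeatedPlay.psmr {dx dy : ℕ} {G : BilinearGame dx dy} {Ω : Type*} [MeasurableSpace Ω]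
    {μ : Measure Ω} (P : RepeatedPlay G μ) (T : ℕ) : ℝ :=
  ∫ ω, ∑ t ∈ Finset.Icc 1 T, (G.maximinValue - G.u (P.x t ω) (P.y t ω)) ∂μ

namespace PureLinUCB

variable {dx dy : ℕ}

/-- `vec(x yᵀ)`, a vector with `dx * dy` coordinates (indexed by pairs). -/
def feature (x : EuclideanSpace ℝ (Fin dx)) (y : EuclideanSpace ℝ (Fin dy)) :
    Fin dy × Fin dx → ℝ :=
  Matrix.vec (Matrix.vecMulVec x.ofLp y.ofLp)

/-- The inverse of `Matrix.vec`. -/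
def mat (v : Fin dy × Fin dx → ℝ) : Matrix (Fin dx) (Fin dy) ℝ :=
  Matrix.of fun i j => v (j, i)

/-- The covariance matrix: `V_0 = lam • I`, `V_t = V_{t-1} + a_t a_tᵀ`. -/
def covMatrix (lam : ℝ) (a : ℕ → Fin dy × Fin dx → ℝ) :
    ℕ → Matrix (Fin dy × Fin dx) (Fin dy × Fin dx) ℝ
  | 0 => lam • (1 : Matrix (Fin dy × Fin dx) (Fin dy × Fin dx) ℝ)
  | t + 1 => covMatrix lam a t + Matrix.vecMulVec (a (t + 1)) (a (t + 1))

/-- The bias vector: `b_0 = 0`, `b_t = b_{t-1} + r_t a_t`. -/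
def biasVec (a : ℕ → Fin dy × Fin dx → ℝ) (r : ℕ → ℝ) : ℕ → Fin dy × Fin dx → ℝ
  | 0 => 0
  | t + 1 => biasVec a r t + r (t + 1) • a (t + 1)

/-- The ridge estimate `mat(V_{t-1}⁻¹ b_{t-1})` used in round `t ≥ 1`. -/
def estimate (lam : ℝ) (a : ℕ → Fin dy × Fin dx → ℝ) (r : ℕ → ℝ) (t : ℕ) :
    Matrix (Fin dx) (Fin dy) ℝ :=
  mat ((covMatrix lam a (t - 1))⁻¹ *ᵥ biasVec a r (t - 1))

/-- The upper confidence bound of round `t ≥ 1`: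
`U_t(x, y) = ⟨x, Â_t y⟩ + β_t ‖vec(x yᵀ)‖_{V_{t-1}⁻¹}`. -/
def ucb (lam : ℝ) (β : ℕ → ℝ) (a : ℕ → Fin dy × Fin dx → ℝ) (r : ℕ → ℝ) (t : ℕ)
    (x : EuclideanSpace ℝ (Fin dx)) (y : EuclideanSpace ℝ (Fin dy)) : ℝ :=
  x.ofLp ⬝ᵥ (estimate lam a r t *ᵥ y.ofLp) +
    β t * √(feature x y ⬝ᵥ ((covMatrix lam a (t - 1))⁻¹ *ᵥ feature x y))

/-- The confidence multiplier, for `d = dx * dy`: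
`β_t = √(lam d) + √(2 log(1/δ) + d log(1 + t / (d lam)))`. -/
def radius (d : ℕ) (lam δ : ℝ) (t : ℕ) : ℝ :=
  √(lam * d) + √(2 * Real.log δ⁻¹ + d * Real.log (1 + t / (d * lam)))

end PureLinUCB

/-- The learner plays PureLinUCB with parameters `lam` and `β`: in every round `t ≥ 1` her action
maximizes `x ↦ min_{y ∈ Y} U_t(x, y)` over `X`, where `U_t` is computed from the actions of both
players and the rewards of rounds `1, …, t - 1`; ties are broken arbitrarily. -/
def RepeatedPlay.FollowsPureLinUCB {dx dy : ℕ} {G : BilinearGame dx dy} {Ω : Type*}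
    [MeasurableSpace Ω] {μ : Measure Ω} (P : RepeatedPlay G μ) (lam : ℝ) (β : ℕ → ℝ) : Prop :=
  ∀ t, 1 ≤ t → ∀ᵐ ω ∂μ,
    IsMaxOn
      (fun x => G.Y.inf' G.Y_nonempty fun y =>
        PureLinUCB.ucb lam β (fun s => PureLinUCB.feature (P.x s ω) (P.y s ω))
          (fun s => P.r s ω) t x y)
      (G.X : Set (EuclideanSpace ℝ (Fin dx))) (P.x t ω)

end

/-! Put `d = dx * dy` and view the game as a linear bandit with parameter `θ = vec A` and features
`vec (x yᵀ)`. If the confidence bound holds in round `t`, then `U_t` dominates `u`, so its maximin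
value is at least `v⋆`. The adversary's reply can only raise `U_t (x_t, y_t)` above the minimum over
`Y`. Hence the regret of the round is at most `2 β_t √w_t`, where `w_t` is the squared
`V_{t-1}⁻¹`-norm of the chosen feature. The observed `y_t` is what puts this feature into `V_t`, so
the elliptical potential lemma bounds `∑ w_t` by a multiple of `d log T`. Cauchy-Schwarz then gives
the `√T` bound. With a gap, `ρ ≤ ρ² / Δ` in rounds of positive regret gives the `log² T` bound.

The confidence bound rests on `M_t = exp (‖S_t‖² / 2) / √det V_t`, with `S_t` the noise-weighted sum
of features and the norm that of `V_t⁻¹`. Its expectation is at most `1`, which is proved one round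
at a time. A rank-one update multiplies `M` by `growth / √(1 + w)`, and `growth` is convex in the
noise `e`. It therefore lies below its chord over the noise range (`growth_le_chord`). The value of
the chord at `e = 0` is the mean under a centred two-point law, at most `√(1 + w)` by Hoeffding's
lemma averaged over a Gaussian (`two_point_growth_le`). The linear part of the chord has conditional
mean zero.

No maximal inequality is needed. A round whose confidence bound fails has `M_{t-1} ≥ T`, so its
regret, at most `2`, is at most `(2 / T) M_{t-1}`. Such rounds cost at most `2` in expectation
altogether. -/

noncomputable section

/-! ### Quadratic forms, determinants and rank-one updates -/

section QuadraticForms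

variable {ι : Type*} [Fintype ι]

theorem Matrix.PosSemidef.dotProduct_mulVec_sq_le {W : Matrix ι ι ℝ} (hW : W.PosSemidef)
    (f g : ι → ℝ) : (f ⬝ᵥ (W *ᵥ g)) ^ 2 ≤ (f ⬝ᵥ (W *ᵥ f)) * (g ⬝ᵥ (W *ᵥ g)) := by
  have hsymm : g ⬝ᵥ (W *ᵥ f) = f ⬝ᵥ (W *ᵥ g) := by
    have hT : Wᵀ = W := by simpa using hW.isHermitian.eq
    rw [Matrix.dotProduct_mulVec, ← Matrix.mulVec_transpose, hT, dotProduct_comm]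
  have h : ∀ c : ℝ, 0 ≤ (f ⬝ᵥ (W *ᵥ f)) * (c * c) + (2 * (f ⬝ᵥ (W *ᵥ g))) * c
      + (g ⬝ᵥ (W *ᵥ g)) := by
    intro c
    have h := hW.dotProduct_mulVec_nonneg (c • f + g)
    simp only [star_trivial, Matrix.mulVec_add, Matrix.mulVec_smul, add_dotProduct,
      dotProduct_add, smul_dotProduct, dotProduct_smul, smul_eq_mul, hsymm] at h
    linarith
  have := discrim_le_zero h
  rw [discrim] at this
  linarith

theorem dotProduct_self_nonneg_real (f : ι → ℝ) : 0 ≤ f ⬝ᵥ f :=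
  Finset.sum_nonneg fun i _ => mul_self_nonneg (f i)

theorem dotProduct_sq_le (f g : ι → ℝ) : (f ⬝ᵥ g) ^ 2 ≤ (f ⬝ᵥ f) * (g ⬝ᵥ g) := by
  classical
  simpa using (Matrix.PosSemidef.one (n := ι) (R := ℝ)).dotProduct_mulVec_sq_le f g

theorem vecMulVec_mulVec_real (a z : ι → ℝ) : Matrix.vecMulVec a a *ᵥ z = (a ⬝ᵥ z) • a := by
  ext i
  simp [Matrix.mulVec, Matrix.vecMulVec_apply, dotProduct, Finset.mul_sum, mul_comm, mul_left_comm]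

theorem Matrix.PosDef.add_vecMulVec {V : Matrix ι ι ℝ} (hV : V.PosDef) (a : ι → ℝ) :
    (V + Matrix.vecMulVec a a).PosDef :=
  hV.add_posSemidef (by simpa using Matrix.posSemidef_vecMulVec_self_star a)

variable [DecidableEq ι]

theorem Matrix.PosDef.mulVec_inv_mulVec {V : Matrix ι ι ℝ} (hV : V.PosDef) (f : ι → ℝ) :
    V *ᵥ (V⁻¹ *ᵥ f) = f := by
  rw [Matrix.mulVec_mulVec, Matrix.mul_nonsing_inv _ ((Matrix.isUnit_iff_isUnit_det _).1 hV.isUnit),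
    Matrix.one_mulVec]

theorem Matrix.PosDef.inv_mulVec_eq {V : Matrix ι ι ℝ} (hV : V.PosDef) {f g : ι → ℝ}
    (h : V *ᵥ g = f) : V⁻¹ *ᵥ f = g := by
  rw [← h, Matrix.mulVec_mulVec,
    Matrix.nonsing_inv_mul _ ((Matrix.isUnit_iff_isUnit_det _).1 hV.isUnit), Matrix.one_mulVec]

theorem Matrix.PosDef.dotProduct_inv_mulVec_nonneg {V : Matrix ι ι ℝ} (hV : V.PosDef)
    (f : ι → ℝ) : 0 ≤ f ⬝ᵥ (V⁻¹ *ᵥ f) := by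
  simpa using hV.inv.posSemidef.dotProduct_mulVec_nonneg f

theorem Matrix.PosDef.dotProduct_inv_mulVec_comm {V : Matrix ι ι ℝ} (hV : V.PosDef)
    (f g : ι → ℝ) : f ⬝ᵥ (V⁻¹ *ᵥ g) = g ⬝ᵥ (V⁻¹ *ᵥ f) := by
  have hT : (V⁻¹)ᵀ = V⁻¹ := by simpa using hV.inv.isHermitian.eq
  rw [Matrix.dotProduct_mulVec, ← Matrix.mulVec_transpose, hT, dotProduct_comm]

/-- If `V` dominates the identity, then `V⁻¹` is dominated by it. -/
theorem Matrix.PosDef.dotProduct_inv_mulVec_le {V : Matrix ι ι ℝ} (hV : V.PosDef)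
    (h1 : ∀ z, z ⬝ᵥ z ≤ z ⬝ᵥ (V *ᵥ z)) (f : ι → ℝ) : f ⬝ᵥ (V⁻¹ *ᵥ f) ≤ f ⬝ᵥ f := by
  set z := V⁻¹ *ᵥ f with hz
  have hVz : V *ᵥ z = f := hV.mulVec_inv_mulVec f
  have h2 : z ⬝ᵥ z ≤ f ⬝ᵥ z := by
    have := h1 z
    rwa [hVz, dotProduct_comm z f] at this
  have h3 := dotProduct_sq_le f z
  have h4 := dotProduct_self_nonneg_real f
  have h5 := dotProduct_self_nonneg_real z
  -- With `z = V⁻¹ f`, Cauchy-Schwarz gives `(f ⬝ᵥ z)² ≤ (f ⬝ᵥ f) (f ⬝ᵥ z)`. The factor `f ⬝ᵥ z` can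
  -- be cancelled unless it is zero.
  rcases (h5.trans h2).eq_or_lt with h0 | h0
  · rw [← h0]; exact h4
  · nlinarith

/-- The matrix determinant lemma for a rank-one update. -/
theorem Matrix.PosDef.det_add_vecMulVec {V : Matrix ι ι ℝ} (hV : V.PosDef) (a : ι → ℝ) :
    (V + Matrix.vecMulVec a a).det = V.det * (1 + a ⬝ᵥ (V⁻¹ *ᵥ a)) := by
  have h := Matrix.det_add_replicateCol_mul_replicateRow (ι := Unit)
    ((Matrix.isUnit_iff_isUnit_det _).1 hV.isUnit) a a
  rw [← Matrix.vecMulVec_eq] at h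
  rw [h, Matrix.dotProduct_mulVec]
  congr 1
  rw [Matrix.det_unique]
  simp [Matrix.mul_apply, Matrix.add_apply, Matrix.vecMul, dotProduct]

/-- Effect of a rank-one update of `V` on the quadratic form of `V⁻¹`. -/
theorem Matrix.PosDef.rank_one_update {V : Matrix ι ι ℝ} (hV : V.PosDef) (a S : ι → ℝ) (e : ℝ) :
    (S + e • a) ⬝ᵥ ((V + Matrix.vecMulVec a a)⁻¹ *ᵥ (S + e • a)) = S ⬝ᵥ (V⁻¹ *ᵥ S) +
      (e ^ 2 - (e - a ⬝ᵥ (V⁻¹ *ᵥ S)) ^ 2 / (1 + a ⬝ᵥ (V⁻¹ *ᵥ a))) := by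
  have hw := hV.dotProduct_inv_mulVec_nonneg a
  have hs := hV.dotProduct_inv_mulVec_comm S a
  have hp := hV.mulVec_inv_mulVec a
  have hq := hV.mulVec_inv_mulVec S
  set p := V⁻¹ *ᵥ a
  set q := V⁻¹ *ᵥ S
  have hw1 : (1 + a ⬝ᵥ p) ≠ 0 := by positivity
  -- The Sherman-Morrison solution, checked by multiplying out.
  have key : (V + Matrix.vecMulVec a a) *ᵥ (q + ((e - a ⬝ᵥ q) / (1 + a ⬝ᵥ p)) • p)
      = S + e • a := by
    rw [Matrix.add_mulVec, vecMulVec_mulVec_real, Matrix.mulVec_add, Matrix.mulVec_smul, hp, hq,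
      dotProduct_add, dotProduct_smul, add_assoc, ← add_smul, smul_eq_mul]
    congr 2
    field_simp
    ring
  rw [(hV.add_vecMulVec a).inv_mulVec_eq key]
  simp only [add_dotProduct, dotProduct_add, smul_dotProduct, dotProduct_smul, smul_eq_mul, hs]
  field_simp
  ring

/-- AM-GM for the eigenvalues: `log` lies below its tangent line at `c`, and summing the tangent
bounds leaves only the trace. -/
theorem Matrix.PosDef.log_det_le {V : Matrix ι ι ℝ} (hV : V.PosDef) {c : ℝ} (hc : 0 < c)
    (htr : V.trace ≤ c * Fintype.card ι) : Real.log V.det ≤ Fintype.card ι * Real.log c := by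
  have hpos := hV.eigenvalues_pos
  have hdet : V.det = ∏ i, hV.isHermitian.eigenvalues i := by
    simpa using hV.isHermitian.det_eq_prod_eigenvalues
  have htrace : V.trace = ∑ i, hV.isHermitian.eigenvalues i := by
    simpa using hV.isHermitian.trace_eq_sum_eigenvalues
  rw [hdet, Real.log_prod fun i _ => (hpos i).ne']
  have h1 : ∀ i, Real.log (hV.isHermitian.eigenvalues i) ≤
      Real.log c + (hV.isHermitian.eigenvalues i / c - 1) := by
    intro i
    have := Real.log_le_sub_one_of_pos (div_pos (hpos i) hc)
    rw [Real.log_div (hpos i).ne' hc.ne'] at this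
    linarith
  refine (Finset.sum_le_sum fun i _ => h1 i).trans ?_
  rw [Finset.sum_add_distrib, Finset.sum_sub_distrib, ← Finset.sum_div, ← htrace]
  have : V.trace / c ≤ Fintype.card ι := by
    rw [div_le_iff₀ hc]; linarith
  simp
  linarith

end QuadraticForms

/-! ### One-step growth of the exponential process -/

/-- The factor by which the exponential of half the self-normalized square grows in one round. -/
def growth (w s e : ℝ) : ℝ :=
  Real.exp ((e ^ 2 - (e - s) ^ 2 / (1 + w)) / 2)

theorem growth_pos (w s e : ℝ) : 0 < growth w s e := Real.exp_pos _

theorem growth_le {w s e : ℝ} (hw : 0 ≤ w) (he : |e| ≤ 2) : growth w s e ≤ Real.exp 2 := by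
  apply Real.exp_le_exp.2
  have h1 : 0 ≤ (e - s) ^ 2 / (1 + w) := by positivity
  have h2 : e ^ 2 ≤ 2 ^ 2 := sq_le_sq' (by linarith [(abs_le.1 he).1]) (abs_le.1 he).2
  linarith

/-- The coefficient of `e ^ 2` in the exponent is `w / (1 + w) / 2 ≥ 0`, and `exp` is increasing and
convex. -/
theorem convexOn_growth {w : ℝ} (hw : 0 ≤ w) (s : ℝ) : ConvexOn ℝ Set.univ (growth w s) := by
  refine ⟨convex_univ, fun x _ y _ a b ha hb hab => ?_⟩
  have h := convexOn_exp.2 (Set.mem_univ ((x ^ 2 - (x - s) ^ 2 / (1 + w)) / 2))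
    (Set.mem_univ ((y ^ 2 - (y - s) ^ 2 / (1 + w)) / 2)) ha hb hab
  refine le_trans (Real.exp_le_exp.2 ?_) h
  obtain rfl : b = 1 - a := by linarith
  have key : a * ((x ^ 2 - (x - s) ^ 2 / (1 + w)) / 2) +
      (1 - a) * ((y ^ 2 - (y - s) ^ 2 / (1 + w)) / 2) -
      ((a * x + (1 - a) * y) ^ 2 - (a * x + (1 - a) * y - s) ^ 2 / (1 + w)) / 2 =
      a * (1 - a) * (x - y) ^ 2 * (w / (1 + w)) / 2 := by
    field_simp
    ring
  have : 0 ≤ a * (1 - a) * (x - y) ^ 2 * (w / (1 + w)) / 2 := by positivity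
  simp only [smul_eq_mul]
  linarith

/-- Hoeffding's lemma for a centred two-point distribution. -/
theorem two_point_exp_le {v : ℝ} (h1 : -1 ≤ v) (h2 : v ≤ 1) (l : ℝ) :
    (1 + v) / 2 * Real.exp (l * (1 - v)) + (1 - v) / 2 * Real.exp (l * (-1 - v)) ≤
      Real.exp (l ^ 2 / 2) := by
  -- The law of the noise when the reward is `±1` with mean `v`. Its support spans an interval of
  -- length `2`, so the sub-Gaussian parameter is `1`.
  let μ : Measure ℝ := ENNReal.ofReal ((1 + v) / 2) • Measure.dirac (1 - v) +
    ENNReal.ofReal ((1 - v) / 2) • Measure.dirac (-1 - v)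
  have hp : (0 : ℝ) ≤ (1 + v) / 2 := by linarith
  have hq : (0 : ℝ) ≤ (1 - v) / 2 := by linarith
  have hμ : IsProbabilityMeasure μ := by
    constructor
    simp only [μ, Measure.add_apply, Measure.smul_apply, measure_univ, smul_eq_mul, mul_one]
    rw [← ENNReal.ofReal_add hp hq]
    simp [show (1 + v) / 2 + (1 - v) / 2 = 1 by ring]
  have hint : ∀ f : ℝ → ℝ, ∫ x, f x ∂μ = (1 + v) / 2 * f (1 - v) + (1 - v) / 2 * f (-1 - v) := by
    intro f
    rw [integral_add_measure ((integrable_dirac (by simp)).smul_measure ENNReal.ofReal_ne_top)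
      ((integrable_dirac (by simp)).smul_measure ENNReal.ofReal_ne_top)]
    simp [integral_smul_measure, ENNReal.toReal_ofReal hp, ENNReal.toReal_ofReal hq]
  have hsub := ProbabilityTheory.hasSubgaussianMGF_of_mem_Icc_of_integral_eq_zero (μ := μ)
    (X := id) (a := -1 - v) (b := 1 - v) aemeasurable_id
    (by
      rw [ae_add_measure_iff]
      constructor <;> refine Measure.ae_smul_measure ?_ _ <;>
        simp [ae_dirac_eq]) (by rw [hint]; simp; ring)
  have := hsub.mgf_le l
  rw [ProbabilityTheory.mgf, hint] at this
  have hn : ((‖(1 - v) - (-1 - v)‖₊ / 2 : NNReal) : ℝ) = 1 := by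
    rw [show (1 - v) - (-1 - v) = (2 : ℝ) by ring]; simp
  rw [NNReal.coe_pow, hn] at this
  simpa using this

theorem integrable_exp_quadratic {b : ℝ} (hb : 0 < b) (c k : ℝ) :
    Integrable fun x : ℝ => Real.exp (-b * (x - c) ^ 2 + k) := by
  have := ((integrable_exp_neg_mul_sq hb).comp_sub_right c).mul_const (Real.exp k)
  simpa [Real.exp_add] using this

theorem integral_exp_quadratic (b c k : ℝ) :
    ∫ x : ℝ, Real.exp (-b * (x - c) ^ 2 + k) = √(Real.pi / b) * Real.exp k := by
  simp_rw [Real.exp_add]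
  rw [integral_mul_const, integral_sub_right_eq_self (fun x => Real.exp (-b * x ^ 2)),
    integral_gaussian]

/-- `growth` as a Gaussian mixture of exponentials. -/
theorem exp_mixture_eq {w : ℝ} (hw : 0 < w) (s e l : ℝ) :
    l * e - l ^ 2 / 2 - (l - s) ^ 2 / (2 * w) =
      -((1 + w) / (2 * w)) * (l - (e * w + s) / (1 + w)) ^ 2 +
        (e ^ 2 - (e - s) ^ 2 / (1 + w)) / 2 := by
  field_simp
  ring

/-- Averaging Hoeffding's bound over `l` with the Gaussian weight of mean `s` and variance `w` turns
`exp (l * e - l ^ 2 / 2)` into `growth / √(1 + w)`. -/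
theorem two_point_growth_le {v w : ℝ} (h1 : -1 ≤ v) (h2 : v ≤ 1) (hw : 0 ≤ w) (s : ℝ) :
    (1 + v) / 2 * growth w s (1 - v) + (1 - v) / 2 * growth w s (-1 - v) ≤ √(1 + w) := by
  -- For `w = 0` the Gaussian degenerates to the point `l = s`, and Hoeffding's bound is used there
  -- directly.
  rcases hw.eq_or_lt with rfl | hw
  · have h := two_point_exp_le h1 h2 s
    have hg : ∀ e, growth 0 s e = Real.exp (-(s ^ 2 / 2)) * Real.exp (s * e) := by
      intro e; rw [growth, ← Real.exp_add]; congr 1; ring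
    rw [hg, hg]
    calc _ = Real.exp (-(s ^ 2 / 2)) * ((1 + v) / 2 * Real.exp (s * (1 - v)) +
          (1 - v) / 2 * Real.exp (s * (-1 - v))) := by ring
      _ ≤ Real.exp (-(s ^ 2 / 2)) * Real.exp (s ^ 2 / 2) := by gcongr
      _ = √(1 + 0) := by rw [← Real.exp_add]; simp
  · have hb : 0 < (1 + w) / (2 * w) := by positivity
    have hint : ∀ e, Integrable fun l : ℝ =>
        Real.exp (l * e - l ^ 2 / 2 - (l - s) ^ 2 / (2 * w)) := by
      intro e
      simp_rw [exp_mixture_eq hw]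
      exact integrable_exp_quadratic hb _ _
    have hval : ∀ e, ∫ l : ℝ, Real.exp (l * e - l ^ 2 / 2 - (l - s) ^ 2 / (2 * w)) =
        √(Real.pi / ((1 + w) / (2 * w))) * growth w s e := by
      intro e
      simp_rw [exp_mixture_eq hw]
      exact integral_exp_quadratic _ _ _
    have hR : Integrable fun l : ℝ => Real.exp (-(1 / (2 * w)) * (l - s) ^ 2 + 0) :=
      integrable_exp_quadratic (by positivity) _ _
    have hmono := integral_mono
      (((hint (1 - v)).const_mul ((1 + v) / 2)).add ((hint (-1 - v)).const_mul ((1 - v) / 2)))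
      hR (fun l => by
        have h := two_point_exp_le h1 h2 l
        have hg : ∀ e, Real.exp (l * e - l ^ 2 / 2 - (l - s) ^ 2 / (2 * w)) =
            Real.exp (-(l ^ 2 / 2) - (l - s) ^ 2 / (2 * w)) * Real.exp (l * e) := by
          intro e; rw [← Real.exp_add]; congr 1; ring
        simp only [Pi.add_apply]
        rw [hg, hg]
        calc _ = Real.exp (-(l ^ 2 / 2) - (l - s) ^ 2 / (2 * w)) *
              ((1 + v) / 2 * Real.exp (l * (1 - v)) + (1 - v) / 2 * Real.exp (l * (-1 - v))) := by
              ring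
          _ ≤ Real.exp (-(l ^ 2 / 2) - (l - s) ^ 2 / (2 * w)) * Real.exp (l ^ 2 / 2) := by
              gcongr
          _ = _ := by rw [← Real.exp_add]; congr 1; ring)
    simp only [Pi.add_apply] at hmono
    rw [integral_add ((hint (1 - v)).const_mul _) ((hint (-1 - v)).const_mul _),
      integral_const_mul, integral_const_mul, hval, hval, integral_exp_quadratic] at hmono
    have hc : 0 < √(Real.pi / ((1 + w) / (2 * w))) := by
      apply Real.sqrt_pos.2; have := Real.pi_pos; positivity
    have hs : √(Real.pi / (1 / (2 * w))) = √(Real.pi / ((1 + w) / (2 * w))) * √(1 + w) := by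
      rw [← Real.sqrt_mul (by have := Real.pi_pos; positivity)]
      congr 1
      field_simp
    rw [hs, Real.exp_zero, mul_one] at hmono
    refine le_of_mul_le_mul_left ?_ hc
    linarith

/-- The slope of the chord of `growth` over the range `[-1 - v, 1 - v]` of the noise. -/
def growthSlope (w s v : ℝ) : ℝ :=
  (growth w s (1 - v) - growth w s (-1 - v)) / 2

/-- The constant term of the chord is the two-point mean. The slope involves `w`, `s` and `v` but
not the new noise, so a noise of conditional mean zero integrates it away. -/
theorem growth_le_chord {v w e : ℝ} (h1 : -1 ≤ v) (h2 : v ≤ 1) (hw : 0 ≤ w) (s : ℝ)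
    (he1 : -1 - v ≤ e) (he2 : e ≤ 1 - v) :
    growth w s e ≤ √(1 + w) + growthSlope w s v * e := by
  have h := (convexOn_growth hw s).2 (Set.mem_univ (1 - v)) (Set.mem_univ (-1 - v))
    (show 0 ≤ (e + 1 + v) / 2 by linarith) (show 0 ≤ (1 - v - e) / 2 by linarith) (by ring)
  have h3 := two_point_growth_le h1 h2 hw s
  simp only [smul_eq_mul] at h
  rw [show (e + 1 + v) / 2 * (1 - v) + (1 - v - e) / 2 * (-1 - v) = e by ring] at h
  rw [growthSlope]
  linarith

theorem abs_growthSlope_le {v w : ℝ} (h1 : -1 ≤ v) (h2 : v ≤ 1) (hw : 0 ≤ w) (s : ℝ) :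
    |growthSlope w s v| ≤ Real.exp 2 := by
  have a := growth_le (s := s) hw (show |1 - v| ≤ 2 by rw [abs_le]; constructor <;> linarith)
  have b := growth_le (s := s) hw (show |-1 - v| ≤ 2 by rw [abs_le]; constructor <;> linarith)
  have := growth_pos w s (1 - v)
  have := growth_pos w s (-1 - v)
  rw [growthSlope, abs_le]
  constructor <;> linarith

/-! ### Measurability of matrix expressions -/

section Measurability

variable {Ω ι : Type*} [Fintype ι] {m : MeasurableSpace Ω}

theorem measurable_dotProduct_mulVec {A : Ω → Matrix ι ι ℝ} {f g : Ω → ι → ℝ}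
    (hA : ∀ i j, Measurable fun ω => A ω i j) (hf : Measurable f) (hg : Measurable g) :
    Measurable fun ω => f ω ⬝ᵥ (A ω *ᵥ g ω) := by
  simp only [dotProduct, Matrix.mulVec]
  fun_prop

variable [DecidableEq ι]

theorem measurable_matrix_det {A : Ω → Matrix ι ι ℝ} (hA : ∀ i j, Measurable fun ω => A ω i j) :
    Measurable fun ω => (A ω).det := by
  simp only [Matrix.det_apply']
  fun_prop

theorem measurable_matrix_inv_apply {A : Ω → Matrix ι ι ℝ}
    (hA : ∀ i j, Measurable fun ω => A ω i j) (i j : ι) :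
    Measurable fun ω => (A ω)⁻¹ i j := by
  simp only [Matrix.inv_def, Ring.inverse_eq_inv', Matrix.smul_apply, smul_eq_mul,
    Matrix.adjugate_apply]
  refine (measurable_matrix_det hA).inv.mul (measurable_matrix_det fun k l => ?_)
  simp only [Matrix.updateRow_apply]
  split_ifs
  · exact measurable_const
  · exact hA k l

end Measurability

/-! ### Covariance matrices and the elliptical potential -/

namespace PureLinUCB

variable {dx dy : ℕ}

theorem posDef_covMatrix (a : ℕ → Fin dy × Fin dx → ℝ) (t : ℕ) : (covMatrix 1 a t).PosDef := by
  induction t with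
  | zero => rw [covMatrix, one_smul]; exact Matrix.PosDef.one
  | succ t ih => exact ih.add_vecMulVec _

theorem dotProduct_self_le_covMatrix (a : ℕ → Fin dy × Fin dx → ℝ) (t : ℕ)
    (z : Fin dy × Fin dx → ℝ) : z ⬝ᵥ z ≤ z ⬝ᵥ (covMatrix 1 a t *ᵥ z) := by
  induction t with
  | zero => simp [covMatrix]
  | succ t ih =>
    rw [covMatrix, Matrix.add_mulVec, vecMulVec_mulVec_real, dotProduct_add, dotProduct_smul,
      smul_eq_mul, dotProduct_comm (a (t + 1)) z]
    have := mul_self_nonneg (z ⬝ᵥ a (t + 1))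
    linarith

theorem trace_covMatrix_le {a : ℕ → Fin dy × Fin dx → ℝ} (ha : ∀ s, 1 ≤ s → a s ⬝ᵥ a s ≤ 1)
    (t : ℕ) : (covMatrix 1 a t).trace ≤ Fintype.card (Fin dy × Fin dx) + t := by
  induction t with
  | zero => rw [covMatrix, one_smul, Matrix.trace_one]; simp
  | succ t ih =>
    rw [covMatrix, Matrix.trace_add, Matrix.trace_vecMulVec]
    have := ha (t + 1) (by lia)
    push_cast
    linarith

/-- The squared `V_{t-1}⁻¹`-norm of the feature vector chosen in round `t`. -/
def width (a : ℕ → Fin dy × Fin dx → ℝ) (t : ℕ) : ℝ :=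
  a t ⬝ᵥ ((covMatrix 1 a (t - 1))⁻¹ *ᵥ a t)

theorem width_nonneg (a : ℕ → Fin dy × Fin dx → ℝ) (t : ℕ) : 0 ≤ width a t :=
  (posDef_covMatrix a (t - 1)).dotProduct_inv_mulVec_nonneg _

theorem width_le_one {a : ℕ → Fin dy × Fin dx → ℝ} {t : ℕ} (ha : a t ⬝ᵥ a t ≤ 1) :
    width a t ≤ 1 :=
  ((posDef_covMatrix a (t - 1)).dotProduct_inv_mulVec_le
    (dotProduct_self_le_covMatrix a _) _).trans ha

theorem det_covMatrix_succ (a : ℕ → Fin dy × Fin dx → ℝ) (t : ℕ) :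
    (covMatrix 1 a (t + 1)).det = (covMatrix 1 a t).det * (1 + width a (t + 1)) :=
  (posDef_covMatrix a t).det_add_vecMulVec _

/-- The elliptical potential lemma. -/
theorem sum_width_le {a : ℕ → Fin dy × Fin dx → ℝ} (ha : ∀ s, 1 ≤ s → a s ⬝ᵥ a s ≤ 1) (t : ℕ) :
    ∑ s ∈ Finset.Icc 1 t, width a s ≤ 2 * Real.log (covMatrix 1 a t).det := by
  induction t with
  | zero => simp [covMatrix]
  | succ t ih =>
    have h0 := width_nonneg a (t + 1)
    have h1 := width_le_one (ha (t + 1) (by lia))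
    rw [Finset.sum_Icc_succ_top (by lia), det_covMatrix_succ,
      Real.log_mul (posDef_covMatrix a t).det_pos.ne' (by positivity)]
    have h2 := Real.one_sub_inv_le_log_of_pos (show 0 < 1 + width a (t + 1) by positivity)
    -- Since `w ≤ 1`, `w / 2 ≤ w / (1 + w) ≤ log (1 + w)`, and the last term is the increment of
    -- `log det`.
    have h3 : width a (t + 1) / 2 ≤ 1 - (1 + width a (t + 1))⁻¹ := by
      rw [← sub_nonneg]
      have : 1 - (1 + width a (t + 1))⁻¹ - width a (t + 1) / 2 =
          width a (t + 1) * (1 - width a (t + 1)) / (2 * (1 + width a (t + 1))) := by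
        field_simp; ring
      rw [this]
      have : 0 ≤ 1 - width a (t + 1) := by linarith
      positivity
    linarith

theorem log_det_covMatrix_le {a : ℕ → Fin dy × Fin dx → ℝ}
    (ha : ∀ s, 1 ≤ s → a s ⬝ᵥ a s ≤ 1) (hd : 0 < dx * dy) (t : ℕ) :
    Real.log (covMatrix 1 a t).det ≤ (dx * dy : ℕ) * Real.log (1 + t / (dx * dy : ℕ)) := by
  have hc : Fintype.card (Fin dy × Fin dx) = dx * dy := by simp [mul_comm]
  have hd' : (0 : ℝ) < (dx * dy : ℕ) := by exact_mod_cast hd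
  have h := trace_covMatrix_le ha t
  rw [← hc] at hd' ⊢
  refine (posDef_covMatrix a t).log_det_le (by positivity) (h.trans (le_of_eq ?_))
  field_simp

/-! ### The self-normalized exponential process -/

/-- The exponential process of the self-normalized concentration bound. -/
def expProcess (a : ℕ → Fin dy × Fin dx → ℝ) (e : ℕ → ℝ) (t : ℕ) : ℝ :=
  Real.exp (biasVec a e t ⬝ᵥ ((covMatrix 1 a t)⁻¹ *ᵥ biasVec a e t) / 2) /
    √(covMatrix 1 a t).det

/-- The coefficient of the new noise in the update of the exponential process. -/
def shift (a : ℕ → Fin dy × Fin dx → ℝ) (e : ℕ → ℝ) (t : ℕ) : ℝ :=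
  a t ⬝ᵥ ((covMatrix 1 a (t - 1))⁻¹ *ᵥ biasVec a e (t - 1))

theorem expProcess_zero (a : ℕ → Fin dy × Fin dx → ℝ) (e : ℕ → ℝ) : expProcess a e 0 = 1 := by
  simp [expProcess, covMatrix, biasVec]

theorem expProcess_pos (a : ℕ → Fin dy × Fin dx → ℝ) (e : ℕ → ℝ) (t : ℕ) :
    0 < expProcess a e t :=
  div_pos (Real.exp_pos _) (Real.sqrt_pos.2 (posDef_covMatrix a t).det_pos)

theorem expProcess_succ (a : ℕ → Fin dy × Fin dx → ℝ) (e : ℕ → ℝ) (t : ℕ) :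
    expProcess a e (t + 1) = expProcess a e t *
      (growth (width a (t + 1)) (shift a e (t + 1)) (e (t + 1)) / √(1 + width a (t + 1))) := by
  rw [expProcess, expProcess, det_covMatrix_succ, biasVec, covMatrix,
    (posDef_covMatrix a t).rank_one_update, Real.sqrt_mul (posDef_covMatrix a t).det_pos.le,
    add_div, Real.exp_add, div_mul_div_comm]
  rfl

/-- A crude deterministic bound, serving only integrability. -/
theorem expProcess_le {a : ℕ → Fin dy × Fin dx → ℝ} {e : ℕ → ℝ} {t : ℕ}
    (he : ∀ s ∈ Finset.Icc 1 t, |e s| ≤ 2) : expProcess a e t ≤ Real.exp 2 ^ t := by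
  induction t with
  | zero => rw [expProcess_zero, pow_zero]
  | succ t ih =>
    have hw := width_nonneg a (t + 1)
    have h1 : 1 ≤ √(1 + width a (t + 1)) := Real.one_le_sqrt.2 (by linarith)
    rw [expProcess_succ, pow_succ]
    refine mul_le_mul (ih fun s hs => he s ?_)
      ((div_le_self (growth_pos _ _ _).le h1).trans (growth_le hw (he _ ?_)))
      (div_nonneg (growth_pos _ _ _).le (Real.sqrt_nonneg _)) (by positivity)
    · rw [Finset.mem_Icc] at hs ⊢; lia
    · rw [Finset.mem_Icc]; lia

section Measurability

variable {Ω : Type*} {m : MeasurableSpace Ω} {a : ℕ → Ω → Fin dy × Fin dx → ℝ} {e : ℕ → Ω → ℝ}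
  {t : ℕ}

theorem measurable_covMatrix (ha : ∀ s ∈ Finset.Icc 1 t, Measurable (a s))
    (i j : Fin dy × Fin dx) : Measurable fun ω => covMatrix 1 (fun s => a s ω) t i j := by
  induction t with
  | zero => exact measurable_const
  | succ t ih =>
    have h1 := ih fun s hs => ha s (by rw [Finset.mem_Icc] at hs ⊢; lia)
    have h2 := ha (t + 1) (by rw [Finset.mem_Icc]; lia)
    simp only [covMatrix, Matrix.add_apply, Matrix.vecMulVec_apply]
    fun_prop

theorem measurable_biasVec (ha : ∀ s ∈ Finset.Icc 1 t, Measurable (a s))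
    (he : ∀ s ∈ Finset.Icc 1 t, Measurable (e s)) :
    Measurable fun ω => biasVec (fun s => a s ω) (fun s => e s ω) t := by
  induction t with
  | zero => exact measurable_const
  | succ t ih =>
    have h1 := ih (fun s hs => ha s (by rw [Finset.mem_Icc] at hs ⊢; lia))
      (fun s hs => he s (by rw [Finset.mem_Icc] at hs ⊢; lia))
    have h2 := ha (t + 1) (by rw [Finset.mem_Icc]; lia)
    have h3 := he (t + 1) (by rw [Finset.mem_Icc]; lia)
    exact h1.add (h3.smul h2)

theorem measurable_expProcess (ha : ∀ s ∈ Finset.Icc 1 t, Measurable (a s))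
    (he : ∀ s ∈ Finset.Icc 1 t, Measurable (e s)) :
    Measurable fun ω => expProcess (fun s => a s ω) (fun s => e s ω) t := by
  have hV := measurable_covMatrix ha
  have hS := measurable_biasVec ha he
  exact ((measurable_dotProduct_mulVec (measurable_matrix_inv_apply hV) hS hS).div_const 2).exp.div
    (measurable_matrix_det hV).sqrt

theorem measurable_width (ha : ∀ s ∈ Finset.Icc 1 (t + 1), Measurable (a s)) :
    Measurable fun ω => width (fun s => a s ω) (t + 1) := by
  have hV := measurable_covMatrix (t := t) fun s hs => ha s (by rw [Finset.mem_Icc] at hs ⊢; lia)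
  have h2 := ha (t + 1) (by rw [Finset.mem_Icc]; lia)
  exact measurable_dotProduct_mulVec (measurable_matrix_inv_apply hV) h2 h2

theorem measurable_shift (ha : ∀ s ∈ Finset.Icc 1 (t + 1), Measurable (a s))
    (he : ∀ s ∈ Finset.Icc 1 t, Measurable (e s)) :
    Measurable fun ω => shift (fun s => a s ω) (fun s => e s ω) (t + 1) := by
  have ha' : ∀ s ∈ Finset.Icc 1 t, Measurable (a s) :=
    fun s hs => ha s (by rw [Finset.mem_Icc] at hs ⊢; lia)
  have hV := measurable_covMatrix ha'
  have h2 := ha (t + 1) (by rw [Finset.mem_Icc]; lia)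
  exact measurable_dotProduct_mulVec (measurable_matrix_inv_apply hV) h2 (measurable_biasVec ha' he)

end Measurability

/-! ### Supermartingale step -/

section Supermartingale

variable {Ω : Type*} {m mΩ : MeasurableSpace Ω} {μ : Measure Ω} [IsProbabilityMeasure μ]
  {a : ℕ → Ω → Fin dy × Fin dx → ℝ} {e : ℕ → Ω → ℝ} {t : ℕ}

theorem integrable_expProcess (ha : ∀ s ∈ Finset.Icc 1 t, Measurable (a s))
    (he : ∀ s ∈ Finset.Icc 1 t, Measurable (e s))
    (hb : ∀ s ∈ Finset.Icc 1 t, ∀ᵐ ω ∂μ, |e s ω| ≤ 2) :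
    Integrable (fun ω => expProcess (fun s => a s ω) (fun s => e s ω) t) μ := by
  refine Integrable.of_bound (measurable_expProcess ha he).aestronglyMeasurable (Real.exp 2 ^ t) ?_
  filter_upwards [(Finset.eventually_all _).2 hb] with ω hω
  rw [Real.norm_of_nonneg (expProcess_pos _ _ _).le]
  exact expProcess_le hω

/-- By the chord bound, `M_{t+1} ≤ M_t + k * e_{t+1}` with `k` bounded almost everywhere and
`m`-measurable. Pulling `k` out of the conditional expectation makes the second term integrate to
zero. -/
theorem integral_expProcess_succ_le (hm : m ≤ mΩ) {v : Ω → ℝ}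
    (ha : ∀ s ∈ Finset.Icc 1 (t + 1), Measurable[m] (a s))
    (he : ∀ s ∈ Finset.Icc 1 t, Measurable[m] (e s))
    (het : Measurable (e (t + 1)))
    (hb : ∀ s ∈ Finset.Icc 1 (t + 1), ∀ᵐ ω ∂μ, |e s ω| ≤ 2)
    (hv : Measurable[m] v) (hv1 : ∀ ω, |v ω| ≤ 1)
    (hev : ∀ᵐ ω ∂μ, e (t + 1) ω ∈ Set.Icc (-1 - v ω) (1 - v ω))
    (hc : μ[e (t + 1) | m] =ᵐ[μ] 0) :
    ∫ ω, expProcess (fun s => a s ω) (fun s => e s ω) (t + 1) ∂μ ≤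
      ∫ ω, expProcess (fun s => a s ω) (fun s => e s ω) t ∂μ := by
  have hsub : ∀ s ∈ Finset.Icc 1 t, s ∈ Finset.Icc 1 (t + 1) := fun s hs => by
    rw [Finset.mem_Icc] at hs ⊢; lia
  have ha' : ∀ s ∈ Finset.Icc 1 t, Measurable[m] (a s) := fun s hs => ha s (hsub s hs)
  have hbt : ∀ s ∈ Finset.Icc 1 t, ∀ᵐ ω ∂μ, |e s ω| ≤ 2 := fun s hs => hb s (hsub s hs)
  have he' : ∀ s ∈ Finset.Icc 1 (t + 1), Measurable (e s) := fun s hs => by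
    rcases eq_or_ne s (t + 1) with rfl | h
    · exact het
    · exact (he s (by rw [Finset.mem_Icc] at hs ⊢; lia)).mono hm le_rfl
  set M : Ω → ℝ := fun ω => expProcess (fun s => a s ω) (fun s => e s ω) t with hM
  set k : Ω → ℝ := fun ω => M ω * (growthSlope (width (fun s => a s ω) (t + 1))
    (shift (fun s => a s ω) (fun s => e s ω) (t + 1)) (v ω) / √(1 + width (fun s => a s ω) (t + 1)))
    with hk
  have hMint : Integrable M μ := integrable_expProcess (fun s hs => (ha' s hs).mono hm le_rfl)
    (fun s hs => (he s hs).mono hm le_rfl) hbt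
  have hkm : Measurable[m] k := by
    have h1 : Measurable[m] M := measurable_expProcess ha' he
    have h2 := measurable_width ha
    have h3 := measurable_shift ha he
    simp only [hk, growthSlope, growth]
    fun_prop
  have hkb : ∀ᵐ ω ∂μ, ‖k ω‖ ≤ Real.exp 2 ^ t * Real.exp 2 := by
    filter_upwards [(Finset.eventually_all _).2 hbt] with ω hω
    have hw := width_nonneg (fun s => a s ω) (t + 1)
    have h1 : 1 ≤ √(1 + width (fun s => a s ω) (t + 1)) := Real.one_le_sqrt.2 (by linarith)
    have hv' := abs_le.1 (hv1 ω)
    rw [hk, norm_mul, norm_div, Real.norm_of_nonneg (expProcess_pos _ _ _).le,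
      Real.norm_of_nonneg (Real.sqrt_nonneg _), Real.norm_eq_abs]
    refine mul_le_mul (expProcess_le hω) ((div_le_self (abs_nonneg _) h1).trans
      (abs_growthSlope_le hv'.1 hv'.2 hw _)) (by positivity) (by positivity)
  have heint : Integrable (e (t + 1)) μ := by
    refine Integrable.of_bound het.aestronglyMeasurable 2 ?_
    simpa using hb (t + 1) (by rw [Finset.mem_Icc]; lia)
  have hkeint : Integrable (k * e (t + 1)) μ :=
    heint.bdd_mul (hkm.mono hm le_rfl).aestronglyMeasurable hkb
  have hzero : ∫ ω, (k * e (t + 1)) ω ∂μ = 0 := by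
    rw [← integral_condExp hm]
    have h := condExp_mul_of_stronglyMeasurable_left hkm.stronglyMeasurable hkeint heint
    have h0 : μ[k * e (t + 1) | m] =ᵐ[μ] 0 := by
      filter_upwards [h, hc] with ω h1 h2
      rw [h1, Pi.mul_apply, h2, Pi.zero_apply, mul_zero]
    simp [integral_congr_ae h0]
  calc _ ≤ ∫ ω, (M ω + (k * e (t + 1)) ω) ∂μ := by
        refine integral_mono_ae (integrable_expProcess
          (fun s hs => (ha s hs).mono hm le_rfl) he' hb) (hMint.add hkeint) ?_
        filter_upwards [hev] with ω hω
        have hw := width_nonneg (fun s => a s ω) (t + 1)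
        have hs : 0 < √(1 + width (fun s => a s ω) (t + 1)) := Real.sqrt_pos.2 (by positivity)
        have hv' := abs_le.1 (hv1 ω)
        have hg := growth_le_chord hv'.1 hv'.2 hw
          (shift (fun s => a s ω) (fun s => e s ω) (t + 1)) hω.1 hω.2
        simp only [expProcess_succ, hk, Pi.mul_apply]
        have h2 : growth (width (fun s => a s ω) (t + 1))
            (shift (fun s => a s ω) (fun s => e s ω) (t + 1)) (e (t + 1) ω) /
            √(1 + width (fun s => a s ω) (t + 1)) ≤ 1 + growthSlope (width (fun s => a s ω) (t + 1))
              (shift (fun s => a s ω) (fun s => e s ω) (t + 1)) (v ω) /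
              √(1 + width (fun s => a s ω) (t + 1)) * e (t + 1) ω := by
          rw [div_le_iff₀ hs]
          refine hg.trans (le_of_eq ?_)
          field_simp
        have := mul_le_mul_of_nonneg_left h2 (expProcess_pos (fun s => a s ω) (fun s => e s ω) t).le
        refine this.trans (le_of_eq ?_)
        simp only [hM]
        ring
    _ = ∫ ω, M ω ∂μ := by
        rw [integral_add hMint hkeint, hzero, add_zero]

end Supermartingale

end PureLinUCB

/-! ### Bounds on the utility, and optimism -/

namespace BilinearGame

variable {dx dy : ℕ} (G : BilinearGame dx dy)

theorem exists_maximinValue_eq : ∃ x ∈ G.X, ∃ y ∈ G.Y, G.maximinValue = G.u x y := by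
  obtain ⟨x, hx, h1⟩ := Finset.exists_mem_eq_sup' G.X_nonempty
    fun x => G.Y.inf' G.Y_nonempty fun y => G.u x y
  obtain ⟨y, hy, h2⟩ := Finset.exists_mem_eq_inf' G.Y_nonempty fun y => G.u x y
  exact ⟨x, hx, y, hy, h1.trans h2⟩

theorem abs_dotProduct_mulVec_le (x : EuclideanSpace ℝ (Fin dx)) (y : EuclideanSpace ℝ (Fin dy)) :
    |x.ofLp ⬝ᵥ (G.A *ᵥ y.ofLp)| ≤ ‖x‖ * ‖y‖ := by
  have h1 : x.ofLp ⬝ᵥ (G.A *ᵥ y.ofLp) =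
      inner ℝ (LinearMap.toContinuousLinearMap (Matrix.toEuclideanLin G.A) y) x := by
    simp [EuclideanSpace.inner_eq_star_dotProduct, Matrix.toLpLin_apply]
  rw [h1]
  have h2 := (LinearMap.toContinuousLinearMap (Matrix.toEuclideanLin G.A)).le_of_opNorm_le
    G.norm_A_le y
  calc _ ≤ _ := abs_real_inner_le_norm _ _
    _ ≤ (1 * ‖y‖) * ‖x‖ := by gcongr
    _ = _ := by ring

theorem abs_u_le {x : EuclideanSpace ℝ (Fin dx)} {y : EuclideanSpace ℝ (Fin dy)}
    (hx : x ∈ G.X) (hy : y ∈ G.Y) : |G.u x y| ≤ 1 := by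
  refine (G.abs_dotProduct_mulVec_le x y).trans ?_
  exact mul_le_one₀ (G.norm_X_le x hx) (norm_nonneg _) (G.norm_Y_le y hy)

theorem regret_le_two {x : EuclideanSpace ℝ (Fin dx)} {y : EuclideanSpace ℝ (Fin dy)}
    (hx : x ∈ G.X) (hy : y ∈ G.Y) : |G.maximinValue - G.u x y| ≤ 2 := by
  obtain ⟨x', hx', y', hy', h⟩ := G.exists_maximinValue_eq
  rw [h]
  have h1 := abs_le.1 (G.abs_u_le hx' hy')
  have h2 := abs_le.1 (G.abs_u_le hx hy)
  rw [abs_le]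
  constructor <;> linarith

/-- Each entry is `⟨e_i, A e_j⟩`, at most `1` in absolute value. This accounts for the term `√(lam
d)` of the radius. -/
theorem vec_A_dotProduct_self_le : G.A.vec ⬝ᵥ G.A.vec ≤ (dx * dy : ℕ) := by
  have h : ∀ p : Fin dy × Fin dx, G.A.vec p * G.A.vec p ≤ 1 := by
    intro p
    have h1 := G.abs_dotProduct_mulVec_le (EuclideanSpace.single p.2 (1 : ℝ))
      (EuclideanSpace.single p.1 (1 : ℝ))
    simp only [PiLp.norm_single, norm_one, mul_one, PiLp.ofLp_single,
      Matrix.mulVec_single_one, single_one_dotProduct, Matrix.col_apply] at h1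
    have h2 := abs_le.1 h1
    change G.A p.2 p.1 * G.A p.2 p.1 ≤ 1
    nlinarith
  calc _ ≤ ∑ _p : Fin dy × Fin dx, (1 : ℝ) := Finset.sum_le_sum fun p _ => h p
    _ = _ := by simp [mul_comm]

/-- A maximizer of an optimistic estimate of the pure maximin value has small regret. -/
theorem regret_le_of_isMaxOn {U W : EuclideanSpace ℝ (Fin dx) → EuclideanSpace ℝ (Fin dy) → ℝ}
    (hlow : ∀ x ∈ G.X, ∀ y ∈ G.Y, G.u x y ≤ U x y)
    (hup : ∀ x ∈ G.X, ∀ y ∈ G.Y, U x y ≤ G.u x y + W x y)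
    {x : EuclideanSpace ℝ (Fin dx)} {y : EuclideanSpace ℝ (Fin dy)} (hx : x ∈ G.X) (hy : y ∈ G.Y)
    (hmax : IsMaxOn (fun x => G.Y.inf' G.Y_nonempty fun y => U x y)
      (G.X : Set (EuclideanSpace ℝ (Fin dx))) x) :
    G.maximinValue - G.u x y ≤ W x y := by
  have h1 : G.maximinValue ≤ G.Y.inf' G.Y_nonempty fun y => U x y := by
    refine Finset.sup'_le _ _ fun x' hx' => le_trans ?_ (hmax hx')
    exact Finset.le_inf' _ _ fun y' hy' => (Finset.inf'_le _ hy').trans (hlow x' hx' y' hy')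
  have h2 := Finset.inf'_le (fun y => U x y) hy
  have h3 := hup x hx y hy
  linarith

end BilinearGame

/-! ### Accuracy of the ridge estimate and regret of one round -/

namespace PureLinUCB

variable {dx dy : ℕ}

theorem dotProduct_mulVec_eq_feature (M : Matrix (Fin dx) (Fin dy) ℝ)
    (x : EuclideanSpace ℝ (Fin dx)) (y : EuclideanSpace ℝ (Fin dy)) :
    x.ofLp ⬝ᵥ (M *ᵥ y.ofLp) = feature x y ⬝ᵥ M.vec := by
  simp only [feature, Matrix.vec, dotProduct, Matrix.mulVec, Matrix.vecMulVec_apply,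
    Fintype.sum_prod_type, Finset.mul_sum]
  rw [Finset.sum_comm]
  exact Finset.sum_congr rfl fun j _ => Finset.sum_congr rfl fun i _ => by ring

theorem feature_dotProduct_self (x : EuclideanSpace ℝ (Fin dx)) (y : EuclideanSpace ℝ (Fin dy)) :
    feature x y ⬝ᵥ feature x y = ‖x‖ ^ 2 * ‖y‖ ^ 2 := by
  rw [EuclideanSpace.real_norm_sq_eq, EuclideanSpace.real_norm_sq_eq, Finset.sum_mul_sum,
    Finset.sum_comm]
  simp only [feature, Matrix.vec, dotProduct, Matrix.vecMulVec_apply, Fintype.sum_prod_type]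
  exact Finset.sum_congr rfl fun j _ => Finset.sum_congr rfl fun i _ => by ring

theorem feature_dotProduct_self_le (G : BilinearGame dx dy) {x : EuclideanSpace ℝ (Fin dx)}
    {y : EuclideanSpace ℝ (Fin dy)} (hx : x ∈ G.X) (hy : y ∈ G.Y) :
    feature x y ⬝ᵥ feature x y ≤ 1 := by
  rw [feature_dotProduct_self]
  exact mul_le_one₀ (pow_le_one₀ (norm_nonneg _) (G.norm_X_le x hx)) (sq_nonneg _)
    (pow_le_one₀ (norm_nonneg _) (G.norm_Y_le y hy))

/-- The reward is signal plus noise, and the signal parts add up to `∑ a_s a_sᵀ θ = (V_t - I) θ`. -/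
theorem biasVec_eq (a : ℕ → Fin dy × Fin dx → ℝ) (r : ℕ → ℝ) (θ : Fin dy × Fin dx → ℝ) (t : ℕ) :
    biasVec a r t = biasVec a (fun s => r s - a s ⬝ᵥ θ) t + covMatrix 1 a t *ᵥ θ - θ := by
  induction t with
  | zero => simp [biasVec, covMatrix]
  | succ t ih =>
    rw [biasVec, ih, biasVec, covMatrix, Matrix.add_mulVec, vecMulVec_mulVec_real, sub_smul]
    abel

/-- Accuracy of the ridge estimate in terms of the self-normalized noise. -/
theorem abs_estimate_sub_le (a : ℕ → Fin dy × Fin dx → ℝ) (r : ℕ → ℝ) (θ f : Fin dy × Fin dx → ℝ)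
    (t : ℕ) :
    |f ⬝ᵥ ((covMatrix 1 a t)⁻¹ *ᵥ biasVec a r t) - f ⬝ᵥ θ| ≤
      (√(θ ⬝ᵥ θ) + √(biasVec a (fun s => r s - a s ⬝ᵥ θ) t ⬝ᵥ
        ((covMatrix 1 a t)⁻¹ *ᵥ biasVec a (fun s => r s - a s ⬝ᵥ θ) t))) *
      √(f ⬝ᵥ ((covMatrix 1 a t)⁻¹ *ᵥ f)) := by
  have hV := posDef_covMatrix a t
  rw [biasVec_eq a r θ t]
  set S := biasVec a (fun s => r s - a s ⬝ᵥ θ) t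
  set V := covMatrix 1 a t
  have hcs : ∀ g, |f ⬝ᵥ (V⁻¹ *ᵥ g)| ≤ √(g ⬝ᵥ (V⁻¹ *ᵥ g)) * √(f ⬝ᵥ (V⁻¹ *ᵥ f)) := by
    intro g
    rw [← Real.sqrt_mul (hV.dotProduct_inv_mulVec_nonneg g)]
    refine Real.abs_le_sqrt ?_
    rw [mul_comm]
    exact hV.inv.posSemidef.dotProduct_mulVec_sq_le f g
  have h1 : f ⬝ᵥ (V⁻¹ *ᵥ (S + V *ᵥ θ - θ)) - f ⬝ᵥ θ =
      f ⬝ᵥ (V⁻¹ *ᵥ S) - f ⬝ᵥ (V⁻¹ *ᵥ θ) := by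
    rw [Matrix.mulVec_sub, Matrix.mulVec_add, hV.inv_mulVec_eq rfl, dotProduct_sub,
      dotProduct_add]
    ring
  have h2 : √(θ ⬝ᵥ (V⁻¹ *ᵥ θ)) ≤ √(θ ⬝ᵥ θ) :=
    Real.sqrt_le_sqrt (hV.dotProduct_inv_mulVec_le (dotProduct_self_le_covMatrix a t) θ)
  rw [h1]
  calc _ ≤ |f ⬝ᵥ (V⁻¹ *ᵥ S)| + |f ⬝ᵥ (V⁻¹ *ᵥ θ)| := abs_sub _ _
    _ ≤ √(S ⬝ᵥ (V⁻¹ *ᵥ S)) * √(f ⬝ᵥ (V⁻¹ *ᵥ f)) + √(θ ⬝ᵥ θ) * √(f ⬝ᵥ (V⁻¹ *ᵥ f)) :=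
      add_le_add (hcs S) ((hcs θ).trans (by gcongr))
    _ = _ := by ring

/-- With `c = T = 1 / δ` this is the failure of the confidence bound, read as a lower bound on
`M_t`. -/
theorem le_expProcess_of_lt {a : ℕ → Fin dy × Fin dx → ℝ} {e : ℕ → ℝ} {t : ℕ} {c : ℝ} (hc : 0 < c)
    (h : 2 * Real.log c + Real.log (covMatrix 1 a t).det <
      biasVec a e t ⬝ᵥ ((covMatrix 1 a t)⁻¹ *ᵥ biasVec a e t)) : c ≤ expProcess a e t := by
  have hdet := (posDef_covMatrix a t).det_pos
  rw [expProcess, le_div_iff₀ (Real.sqrt_pos.2 hdet)]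
  rw [← Real.log_le_iff_le_exp (mul_pos hc (Real.sqrt_pos.2 hdet)),
    Real.log_mul hc.ne' (Real.sqrt_pos.2 hdet).ne', Real.log_sqrt hdet.le]
  linarith

/-- In every round, either the regret is controlled by the width of the chosen action pair, or the
exponential process is large. -/
theorem regret_le_or_le_expProcess (G : BilinearGame dx dy) (hd : 0 < dx * dy)
    {x : ℕ → EuclideanSpace ℝ (Fin dx)} {y : ℕ → EuclideanSpace ℝ (Fin dy)} {r : ℕ → ℝ}
    (hx : ∀ s, 1 ≤ s → x s ∈ G.X) (hy : ∀ s, 1 ≤ s → y s ∈ G.Y) {T : ℕ} (hT : 2 ≤ T) {t : ℕ}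
    (ht : 1 ≤ t)
    (hmax : IsMaxOn (fun x' => G.Y.inf' G.Y_nonempty fun y' =>
        ucb 1 (radius (dx * dy) 1 (1 / (T : ℝ))) (fun s => feature (x s) (y s)) r t x' y')
      (G.X : Set (EuclideanSpace ℝ (Fin dx))) (x t)) :
    G.maximinValue - G.u (x t) (y t) ≤
        2 * radius (dx * dy) 1 (1 / (T : ℝ)) t * √(width (fun s => feature (x s) (y s)) t) ∨
      (T : ℝ) ≤ expProcess (fun s => feature (x s) (y s)) (fun s => r s - G.u (x s) (y s))
        (t - 1) := by
  have hT0 : (0 : ℝ) < T := by positivity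
  set a : ℕ → Fin dy × Fin dx → ℝ := fun s => feature (x s) (y s) with ha
  have hu : ∀ x y, G.u x y = feature x y ⬝ᵥ G.A.vec := fun x y =>
    dotProduct_mulVec_eq_feature G.A x y
  have hnoise : (fun s => r s - G.u (x s) (y s)) = fun s => r s - a s ⬝ᵥ G.A.vec := by
    funext s; rw [hu]
  rw [hnoise]
  rcases lt_or_ge (2 * Real.log T + Real.log (covMatrix 1 a (t - 1)).det)
    (biasVec a (fun s => r s - a s ⬝ᵥ G.A.vec) (t - 1) ⬝ᵥ ((covMatrix 1 a (t - 1))⁻¹ *ᵥ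
      biasVec a (fun s => r s - a s ⬝ᵥ G.A.vec) (t - 1))) with h | h
  · exact Or.inr (le_expProcess_of_lt hT0 h)
  left
  have hd' : (0 : ℝ) < (dx * dy : ℕ) := by exact_mod_cast hd
  have hβ : √(G.A.vec ⬝ᵥ G.A.vec) + √(biasVec a (fun s => r s - a s ⬝ᵥ G.A.vec) (t - 1) ⬝ᵥ
      ((covMatrix 1 a (t - 1))⁻¹ *ᵥ biasVec a (fun s => r s - a s ⬝ᵥ G.A.vec) (t - 1))) ≤
      radius (dx * dy) 1 (1 / (T : ℝ)) t := by
    rw [radius]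
    refine add_le_add (Real.sqrt_le_sqrt ?_) (Real.sqrt_le_sqrt (h.trans ?_))
    · rw [one_mul]; exact G.vec_A_dotProduct_self_le
    · rw [one_div, inv_inv, mul_one]
      -- Only `V_{t-1}` enters, so `t - 1` would suffice in the logarithm; the radius has the larger
      -- `t`.
      refine add_le_add_right ((log_det_covMatrix_le (fun s hs =>
        feature_dotProduct_self_le G (hx s hs) (hy s hs)) hd (t - 1)).trans ?_) _
      gcongr
      exact Nat.sub_le t 1
  have hconf : ∀ x' y', |x'.ofLp ⬝ᵥ (estimate 1 a r t *ᵥ y'.ofLp) - G.u x' y'| ≤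
      radius (dx * dy) 1 (1 / (T : ℝ)) t *
        √(feature x' y' ⬝ᵥ ((covMatrix 1 a (t - 1))⁻¹ *ᵥ feature x' y')) := by
    intro x' y'
    rw [dotProduct_mulVec_eq_feature, hu]
    exact (abs_estimate_sub_le a r G.A.vec (feature x' y') (t - 1)).trans
      (mul_le_mul_of_nonneg_right hβ (Real.sqrt_nonneg _))
  refine G.regret_le_of_isMaxOn (W := fun x' y' => 2 * radius (dx * dy) 1 (1 / (T : ℝ)) t *
    √(feature x' y' ⬝ᵥ ((covMatrix 1 a (t - 1))⁻¹ *ᵥ feature x' y')))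
    (fun x' _ y' _ => ?_) (fun x' _ y' _ => ?_) (hx t ht) (hy t ht) hmax
  · have := (abs_le.1 (hconf x' y')).1
    rw [ucb]
    linarith
  · have := (abs_le.1 (hconf x' y')).2
    rw [ucb]
    linarith

/-! ### Numerical bounds for the radius and the widths -/

theorem le_log_of_two_le {T : ℕ} (hT : 2 ≤ T) : 0.69 ≤ Real.log T := by
  have h : Real.log 2 ≤ Real.log T := Real.log_le_log (by norm_num) (by exact_mod_cast hT)
  linarith [Real.log_two_gt_d9]

/-- For `T ≥ 2`, `1 + t / d ≤ 1 + T ≤ T ^ 2`. -/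
theorem log_one_add_div_le {d T : ℕ} (hd : 0 < d) (hT : 2 ≤ T) {t : ℕ} (ht : t ≤ T) :
    Real.log (1 + t / d) ≤ 2 * Real.log T := by
  have hd' : (1 : ℝ) ≤ d := by exact_mod_cast hd
  have hT' : (2 : ℝ) ≤ T := by exact_mod_cast hT
  have ht' : (t : ℝ) ≤ T := by exact_mod_cast ht
  have h1 : (t : ℝ) / d ≤ T := (div_le_self (by positivity) hd').trans ht'
  rw [show 2 * Real.log T = Real.log ((T : ℝ) ^ 2) by rw [Real.log_pow]; norm_num]
  refine Real.log_le_log (by positivity) ?_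
  nlinarith

/-- From `(a + b)² ≤ 2 (a² + b²)` the square is at most `2 (d + 2 log T + 2 d log T)`. Absorbing `d`
by `log T ≥ 0.69` gives a factor `2 (1 / 0.69 + 4) < 11`. -/
theorem radius_sq_le {d T : ℕ} (hd : 0 < d) (hT : 2 ≤ T) {t : ℕ} (ht : t ≤ T) :
    radius d 1 (1 / (T : ℝ)) t ^ 2 ≤ 11 * (d * Real.log T) := by
  have hd' : (1 : ℝ) ≤ d := by exact_mod_cast hd
  have hL := le_log_of_two_le hT
  have h1 := log_one_add_div_le hd hT ht
  have h0 : 0 ≤ Real.log (1 + t / (d : ℝ)) :=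
    Real.log_nonneg (by have : (0 : ℝ) ≤ t / d := by positivity
                        linarith)
  rw [radius, one_div, inv_inv, mul_one, one_mul]
  have hs1 := Real.sq_sqrt (show (0 : ℝ) ≤ d by positivity)
  have hs2 := Real.sq_sqrt (show (0 : ℝ) ≤ 2 * Real.log T + d * Real.log (1 + t / d) by positivity)
  have h2 := add_sq_le (a := √(d : ℝ)) (b := √(2 * Real.log T + d * Real.log (1 + t / d)))
  rw [hs1, hs2] at h2
  have h3 : (d : ℝ) * Real.log (1 + t / d) ≤ d * (2 * Real.log T) := by gcongr
  have h4 : Real.log T ≤ d * Real.log T := le_mul_of_one_le_left (by linarith) hd'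
  have h5 : (d : ℝ) * 0.69 ≤ d * Real.log T := by gcongr
  linarith

theorem sum_width_le_log {a : ℕ → Fin dy × Fin dx → ℝ} (ha : ∀ s, 1 ≤ s → a s ⬝ᵥ a s ≤ 1)
    (hd : 0 < dx * dy) {T : ℕ} (hT : 2 ≤ T) :
    ∑ t ∈ Finset.Icc 1 T, width a t ≤ 4 * ((dx * dy : ℕ) * Real.log T) := by
  have h1 := sum_width_le ha T
  have h2 := log_det_covMatrix_le ha hd T
  have h3 : ((dx * dy : ℕ) : ℝ) * Real.log (1 + T / (dx * dy : ℕ)) ≤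
      (dx * dy : ℕ) * (2 * Real.log T) := by
    gcongr
    exact log_one_add_div_le hd hT le_rfl
  linarith

theorem sum_sqrt_le_sqrt {w : ℕ → ℝ} (hw : ∀ t, 0 ≤ w t) (T : ℕ) :
    ∑ t ∈ Finset.Icc 1 T, √(w t) ≤ √(T * ∑ t ∈ Finset.Icc 1 T, w t) := by
  refine Real.le_sqrt_of_sq_le ?_
  have := sq_sum_le_card_mul_sum_sq (s := Finset.Icc 1 T) (f := fun t => √(w t))
  simpa [Real.sq_sqrt (hw _)] using this

end PureLinUCB

/-! ### Measurability of features and utility -/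

namespace PureLinUCB

variable {dx dy : ℕ} {Ω : Type*} {m : MeasurableSpace Ω} {x : Ω → EuclideanSpace ℝ (Fin dx)}
  {y : Ω → EuclideanSpace ℝ (Fin dy)}

theorem measurable_feature (hx : Measurable x) (hy : Measurable y) :
    Measurable fun ω => feature (x ω) (y ω) := by
  refine measurable_pi_lambda _ fun p => ?_
  have h1 : Measurable fun ω => (x ω).ofLp p.2 :=
    (EuclideanSpace.proj (𝕜 := ℝ) p.2).continuous.measurable.comp hx
  have h2 : Measurable fun ω => (y ω).ofLp p.1 :=
    (EuclideanSpace.proj (𝕜 := ℝ) p.1).continuous.measurable.comp hy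
  exact h1.mul h2

theorem measurable_u (G : BilinearGame dx dy) (hx : Measurable x) (hy : Measurable y) :
    Measurable fun ω => G.u (x ω) (y ω) := by
  simp only [BilinearGame.u, dotProduct]
  fun_prop

end PureLinUCB

/-! ### Noise, history and expected regret along the play -/

namespace RepeatedPlay

open PureLinUCB

variable {dx dy : ℕ} {G : BilinearGame dx dy} {Ω : Type*} [mΩ : MeasurableSpace Ω]
  {μ : Measure Ω}

/-- The feature vectors of the action pairs played. -/
def feat (P : RepeatedPlay G μ) (s : ℕ) (ω : Ω) : Fin dy × Fin dx → ℝ :=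
  feature (P.x s ω) (P.y s ω)

/-- The reward noise. -/
def eps (P : RepeatedPlay G μ) (s : ℕ) (ω : Ω) : ℝ :=
  P.r s ω - G.u (P.x s ω) (P.y s ω)

theorem feat_dotProduct_self_le (P : RepeatedPlay G μ) (ω : Ω) (s : ℕ) (hs : 1 ≤ s) :
    P.feat s ω ⬝ᵥ P.feat s ω ≤ 1 :=
  feature_dotProduct_self_le G (P.x_mem s hs ω) (P.y_mem s hs ω)

theorem abs_u_le (P : RepeatedPlay G μ) {s : ℕ} (hs : 1 ≤ s) (ω : Ω) :
    |G.u (P.x s ω) (P.y s ω)| ≤ 1 :=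
  G.abs_u_le (P.x_mem s hs ω) (P.y_mem s hs ω)

theorem eps_mem (P : RepeatedPlay G μ) {s : ℕ} (hs : 1 ≤ s) :
    ∀ᵐ ω ∂μ, P.eps s ω ∈ Set.Icc (-1 - G.u (P.x s ω) (P.y s ω)) (1 - G.u (P.x s ω) (P.y s ω)) := by
  filter_upwards [P.r_mem s hs] with ω hω
  exact ⟨sub_le_sub_right hω.1 _, sub_le_sub_right hω.2 _⟩

theorem abs_eps_le (P : RepeatedPlay G μ) {s : ℕ} (hs : 1 ≤ s) : ∀ᵐ ω ∂μ, |P.eps s ω| ≤ 2 := by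
  filter_upwards [P.eps_mem hs] with ω hω
  have h := abs_le.1 (P.abs_u_le hs ω)
  rw [abs_le]
  constructor <;> linarith [hω.1, hω.2]

/-- The exponential process along the play. -/
def expProc (P : RepeatedPlay G μ) (t : ℕ) (ω : Ω) : ℝ :=
  expProcess (fun s => P.feat s ω) (fun s => P.eps s ω) t

theorem psmr_eq_zero (P : RepeatedPlay G μ) (hd : dx * dy = 0) (T : ℕ) : P.psmr T = 0 := by
  have hu : ∀ x y, G.u x y = 0 := by
    intro x y
    have : IsEmpty (Fin dy × Fin dx) := by
      rcases Nat.mul_eq_zero.1 hd with rfl | rfl <;> infer_instance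
    rw [BilinearGame.u, dotProduct_mulVec_eq_feature]
    simp [dotProduct]
  obtain ⟨x, -, y, -, h⟩ := G.exists_maximinValue_eq
  simp [psmr, h, hu]

/-- The σ-algebra on which the noise of round `t` is conditioned. -/
@[reducible]
def history (P : RepeatedPlay G μ) (t : ℕ) : MeasurableSpace Ω :=
  (⨆ s ∈ Finset.Icc 1 t, (MeasurableSpace.comap (P.x s) inferInstance ⊔
      MeasurableSpace.comap (P.y s) inferInstance)) ⊔
    ⨆ s ∈ Finset.Ico 1 t, MeasurableSpace.comap (P.r s) inferInstance

theorem history_le (P : RepeatedPlay G μ) (t : ℕ) : P.history t ≤ mΩ := by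
  refine sup_le (iSup₂_le fun s hs => ?_) (iSup₂_le fun s hs => ?_)
  · have h1 := (Finset.mem_Icc.1 hs).1
    exact sup_le (P.measurable_x s h1).comap_le (P.measurable_y s h1).comap_le
  · exact (P.measurable_r s (Finset.mem_Ico.1 hs).1).comap_le

theorem comap_actions_le_history (P : RepeatedPlay G μ) {s t : ℕ} (hs : s ∈ Finset.Icc 1 t) :
    MeasurableSpace.comap (P.x s) inferInstance ⊔ MeasurableSpace.comap (P.y s) inferInstance ≤
      P.history t :=
  (le_iSup₂ (f := fun s (_ : s ∈ Finset.Icc 1 t) => MeasurableSpace.comap (P.x s) inferInstance ⊔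
    MeasurableSpace.comap (P.y s) inferInstance) s hs).trans le_sup_left

theorem measurable_x_history (P : RepeatedPlay G μ) {s t : ℕ} (hs : s ∈ Finset.Icc 1 t) :
    Measurable[P.history t] (P.x s) :=
  measurable_iff_comap_le.2 (le_sup_left.trans (P.comap_actions_le_history hs))

theorem measurable_y_history (P : RepeatedPlay G μ) {s t : ℕ} (hs : s ∈ Finset.Icc 1 t) :
    Measurable[P.history t] (P.y s) :=
  measurable_iff_comap_le.2 (le_sup_right.trans (P.comap_actions_le_history hs))

theorem measurable_r_history (P : RepeatedPlay G μ) {s t : ℕ} (hs : s ∈ Finset.Ico 1 t) :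
    Measurable[P.history t] (P.r s) :=
  measurable_iff_comap_le.2 ((le_iSup₂ (f := fun s (_ : s ∈ Finset.Ico 1 t) =>
    MeasurableSpace.comap (P.r s) inferInstance) s hs).trans le_sup_right)

variable [IsProbabilityMeasure μ]

theorem integrable_expProc (P : RepeatedPlay G μ) (t : ℕ) : Integrable (P.expProc t) μ := by
  have h1 : ∀ s ∈ Finset.Icc 1 t, 1 ≤ s := fun s hs => (Finset.mem_Icc.1 hs).1
  exact integrable_expProcess
    (fun s hs => measurable_feature (P.measurable_x s (h1 s hs)) (P.measurable_y s (h1 s hs)))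
    (fun s hs => (P.measurable_r s (h1 s hs)).sub
      (measurable_u G (P.measurable_x s (h1 s hs)) (P.measurable_y s (h1 s hs))))
    (fun s hs => P.abs_eps_le (h1 s hs))

theorem integral_expProc_le_one (P : RepeatedPlay G μ) (t : ℕ) : ∫ ω, P.expProc t ω ∂μ ≤ 1 := by
  induction t with
  | zero => simp [expProc, expProcess_zero]
  | succ t ih =>
    refine le_trans ?_ ih
    have htop : t + 1 ∈ Finset.Icc 1 (t + 1) := by rw [Finset.mem_Icc]; lia
    have hsub : ∀ s ∈ Finset.Icc 1 t, s ∈ Finset.Icc 1 (t + 1) ∧ s ∈ Finset.Ico 1 (t + 1) := by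
      intro s hs
      rw [Finset.mem_Icc] at hs
      rw [Finset.mem_Icc, Finset.mem_Ico]
      lia
    refine integral_expProcess_succ_le (P.history_le (t + 1))
      (fun s hs => measurable_feature (P.measurable_x_history hs) (P.measurable_y_history hs))
      (fun s hs => (P.measurable_r_history (hsub s hs).2).sub (measurable_u G
        (P.measurable_x_history (hsub s hs).1) (P.measurable_y_history (hsub s hs).1)))
      ((P.measurable_r _ (by lia)).sub (measurable_u G (P.measurable_x _ (by lia))
        (P.measurable_y _ (by lia))))
      (fun s hs => P.abs_eps_le (Finset.mem_Icc.1 hs).1)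
      (measurable_u G (P.measurable_x_history htop) (P.measurable_y_history htop))
      (P.abs_u_le (by lia)) (P.eps_mem (by lia)) (P.noise (t + 1) (by lia))

/-- Pointwise bounds `h t` on the regret of the rounds in which the confidence bound holds
give a bound on the expected regret. -/
theorem psmr_le_add_two (P : RepeatedPlay G μ) (hd : 0 < dx * dy) {T : ℕ} (hT : 2 ≤ T)
    (hP : P.FollowsPureLinUCB 1 (radius (dx * dy) 1 (1 / (T : ℝ)))) {h : ℕ → Ω → ℝ} {R : ℝ}
    (h0 : ∀ t ω, 0 ≤ h t ω)
    (hreg : ∀ t ∈ Finset.Icc 1 T, ∀ ω, G.maximinValue - G.u (P.x t ω) (P.y t ω) ≤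
      2 * radius (dx * dy) 1 (1 / (T : ℝ)) t * √(width (fun s => P.feat s ω) t) →
      G.maximinValue - G.u (P.x t ω) (P.y t ω) ≤ h t ω)
    (hR : ∀ ω, ∑ t ∈ Finset.Icc 1 T, h t ω ≤ R) : P.psmr T ≤ R + 2 := by
  have hT0 : (0 : ℝ) < T := by positivity
  have hround : ∀ t ∈ Finset.Icc 1 T, ∀ᵐ ω ∂μ, G.maximinValue - G.u (P.x t ω) (P.y t ω) ≤
      h t ω + 2 / T * P.expProc (t - 1) ω := by
    intro t ht
    have ht1 := (Finset.mem_Icc.1 ht).1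
    filter_upwards [hP t ht1] with ω hω
    have hM := expProcess_pos (fun s => P.feat s ω) (fun s => P.eps s ω) (t - 1)
    rcases regret_le_or_le_expProcess G hd (fun s hs => P.x_mem s hs ω)
      (fun s hs => P.y_mem s hs ω) hT ht1 hω with h1 | h1
    · have h2 := hreg t ht ω h1
      have h3 : 0 ≤ 2 / T * P.expProc (t - 1) ω := mul_nonneg (by positivity) hM.le
      linarith
    · have h2 := (abs_le.1 (G.regret_le_two (P.x_mem t ht1 ω) (P.y_mem t ht1 ω))).2
      -- The failed round is charged to the process itself, in the manner of Markov's inequality;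
      -- its expectation is then at most `2 / T`.
      have h3 : 2 ≤ 2 / T * P.expProc (t - 1) ω := by
        calc (2 : ℝ) = 2 / T * T := by field_simp
          _ ≤ _ := by gcongr; exact h1
      linarith [h0 t ω]
  have hMint : Integrable (fun ω => ∑ t ∈ Finset.Icc 1 T, 2 / T * P.expProc (t - 1) ω) μ :=
    integrable_finsetSum _ fun t _ => (P.integrable_expProc (t - 1)).const_mul _
  have hint : Integrable (fun ω => ∑ t ∈ Finset.Icc 1 T,
      (G.maximinValue - G.u (P.x t ω) (P.y t ω))) μ := by
    refine integrable_finsetSum _ fun t ht => ?_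
    have ht1 := (Finset.mem_Icc.1 ht).1
    refine Integrable.of_bound (measurable_const.sub
      (measurable_u G (P.measurable_x t ht1) (P.measurable_y t ht1))).aestronglyMeasurable 2 ?_
    exact Filter.Eventually.of_forall fun ω =>
      G.regret_le_two (P.x_mem t ht1 ω) (P.y_mem t ht1 ω)
  calc P.psmr T ≤ ∫ ω, (R + ∑ t ∈ Finset.Icc 1 T, 2 / T * P.expProc (t - 1) ω) ∂μ := by
        refine integral_mono_ae hint ((integrable_const R).add hMint) ?_
        filter_upwards [(Finset.eventually_all _).2 hround] with ω hω
        have h1 := Finset.sum_le_sum hω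
        rw [Finset.sum_add_distrib] at h1
        exact h1.trans (add_le_add_left (hR ω) _)
    _ = R + ∑ t ∈ Finset.Icc 1 T, 2 / T * ∫ ω, P.expProc (t - 1) ω ∂μ := by
        rw [integral_add (integrable_const R) hMint, integral_finsetSum _
          fun t _ => (P.integrable_expProc (t - 1)).const_mul _]
        simp [integral_const_mul]
    _ ≤ R + ∑ t ∈ Finset.Icc 1 T, 2 / T * (1 : ℝ) := by
        gcongr
        exact P.integral_expProc_le_one _
    _ = R + 2 := by
        simp
        field_simp

theorem psmr_le_sqrt (P : RepeatedPlay G μ) (hd : 0 < dx * dy) {T : ℕ} (hT : 2 ≤ T)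
    (hP : P.FollowsPureLinUCB 1 (radius (dx * dy) 1 (1 / (T : ℝ)))) :
    P.psmr T ≤ 200 * (dx * dy * √(T : ℝ) * Real.log T) := by
  have hL := le_log_of_two_le hT
  have hd' : (1 : ℝ) ≤ ((dx * dy : ℕ) : ℝ) := by exact_mod_cast hd
  set D : ℝ := ((dx * dy : ℕ) : ℝ) with hD
  have hDL : 0.69 ≤ D * Real.log T := by nlinarith
  have hDL0 : 0 ≤ D * Real.log T := by linarith
  have hrad : ∀ t ∈ Finset.Icc 1 T, radius (dx * dy) 1 (1 / (T : ℝ)) t ≤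
      √(11 * (D * Real.log T)) := fun t ht =>
    Real.le_sqrt_of_sq_le (radius_sq_le hd hT (Finset.mem_Icc.1 ht).2)
  have h := P.psmr_le_add_two hd hT hP
    (h := fun t ω => 2 * √(11 * (D * Real.log T)) * √(width (fun s => P.feat s ω) t))
    (R := 2 * √(11 * (D * Real.log T)) * √(T * (4 * (D * Real.log T))))
    (fun t ω => by positivity)
    (fun t ht ω hω => hω.trans (by gcongr; exact hrad t ht))
    (fun ω => by
      rw [← Finset.mul_sum]
      gcongr
      refine (sum_sqrt_le_sqrt (width_nonneg _) T).trans (Real.sqrt_le_sqrt ?_)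
      gcongr
      exact sum_width_le_log (P.feat_dotProduct_self_le ω) hd hT)
  -- `√(11 * 4) ≤ 7`.
  have h2 : √(11 * (D * Real.log T)) * √(T * (4 * (D * Real.log T))) ≤
      7 * (√(T : ℝ) * (D * Real.log T)) := by
    rw [← Real.sqrt_mul (by positivity)]
    refine Real.sqrt_le_iff.2 ⟨by positivity, ?_⟩
    rw [mul_pow, mul_pow, Real.sq_sqrt (by positivity)]
    have : 0 ≤ (T : ℝ) * (D * Real.log T) ^ 2 := by positivity
    nlinarith
  have h3 : 1 ≤ √(T : ℝ) := Real.one_le_sqrt.2 (by exact_mod_cast (by lia : 1 ≤ T))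
  have h4 : D * Real.log T ≤ √(T : ℝ) * (D * Real.log T) := le_mul_of_one_le_left hDL0 h3
  have h5 : (dx : ℝ) * dy * √(T : ℝ) * Real.log T = √(T : ℝ) * (D * Real.log T) := by
    rw [hD]; push_cast; ring
  rw [h5]
  linarith

/-- A round of positive regret `ρ` has `ρ ≥ Δ`, hence `ρ ≤ ρ² / Δ ≤ 4 β_t² w_t / Δ`. This is linear
in the width, so the potential lemma applies without Cauchy-Schwarz. -/
theorem psmr_le_gap (P : RepeatedPlay G μ) (hd : 0 < dx * dy) {T : ℕ} (hT : 2 ≤ T)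
    (hP : P.FollowsPureLinUCB 1 (radius (dx * dy) 1 (1 / (T : ℝ)))) {Δ : ℝ} (hΔ : G.IsGap Δ) :
    P.psmr T ≤ 200 * (1 / Δ * (dx : ℝ) ^ 2 * (dy : ℝ) ^ 2 * Real.log T ^ 2) := by
  obtain ⟨hΔ0, hgap⟩ := hΔ
  have hL := le_log_of_two_le hT
  have hd' : (1 : ℝ) ≤ ((dx * dy : ℕ) : ℝ) := by exact_mod_cast hd
  set D : ℝ := ((dx * dy : ℕ) : ℝ) with hD
  have hDL : 0.69 ≤ D * Real.log T := by nlinarith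
  have hrhs : 1 / Δ * (dx : ℝ) ^ 2 * (dy : ℝ) ^ 2 * Real.log T ^ 2 =
      (D * Real.log T) ^ 2 / Δ := by
    rw [hD]; push_cast; ring
  rw [hrhs]
  -- A gap above `2` rules out positive regret. Otherwise `Δ ≤ 2` lets the additive `2` be absorbed
  -- into `(D * Real.log T) ^ 2 / Δ`, with `176 + 24 = 200`.
  rcases lt_or_ge 2 Δ with h2 | h2
  · have hneg : P.psmr T ≤ 0 := by
      refine integral_nonpos fun ω => Finset.sum_nonpos fun t ht => ?_
      have ht1 := (Finset.mem_Icc.1 ht).1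
      rcases hgap _ (P.x_mem t ht1 ω) _ (P.y_mem t ht1 ω) with h | h
      · exact h
      · have h3 := (abs_le.1 (G.regret_le_two (P.x_mem t ht1 ω) (P.y_mem t ht1 ω))).2
        have h4 : Δ ≤ _ := h
        linarith
    exact hneg.trans (by positivity)
  have h := P.psmr_le_add_two hd hT hP
    (h := fun t ω => 44 * (D * Real.log T) / Δ * width (fun s => P.feat s ω) t)
    (R := 44 * (D * Real.log T) / Δ * (4 * (D * Real.log T)))
    (fun t ω => mul_nonneg (by positivity) (width_nonneg _ _))
    (fun t ht ω hω => by
      have ht1 := (Finset.mem_Icc.1 ht).1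
      have hw := width_nonneg (fun s => P.feat s ω) t
      rcases hgap _ (P.x_mem t ht1 ω) _ (P.y_mem t ht1 ω) with h | h
      · exact le_trans h (mul_nonneg (by positivity) hw)
      · have h4 : Δ ≤ G.maximinValue - G.u (P.x t ω) (P.y t ω) := h
        set ρ := G.maximinValue - G.u (P.x t ω) (P.y t ω)
        have h5 : ρ ^ 2 ≤ 4 * radius (dx * dy) 1 (1 / (T : ℝ)) t ^ 2 *
            width (fun s => P.feat s ω) t := by
          refine (pow_le_pow_left₀ (by linarith) hω 2).trans (le_of_eq ?_)
          rw [mul_pow, Real.sq_sqrt hw]; ring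
        have h6 : ρ ^ 2 ≤ 44 * (D * Real.log T) * width (fun s => P.feat s ω) t := by
          refine h5.trans (mul_le_mul_of_nonneg_right ?_ hw)
          linarith [radius_sq_le hd hT (Finset.mem_Icc.1 ht).2]
        rw [div_mul_eq_mul_div, le_div_iff₀ hΔ0]
        nlinarith)
    (fun ω => by
      rw [← Finset.mul_sum]
      gcongr
      exact sum_width_le_log (P.feat_dotProduct_self_le ω) hd hT)
  have h3 : 2 ≤ 24 * ((D * Real.log T) ^ 2 / Δ) := by
    rw [← mul_div_assoc, le_div_iff₀ hΔ0]
    nlinarith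
  have h4 : 44 * (D * Real.log T) / Δ * (4 * (D * Real.log T)) =
      176 * ((D * Real.log T) ^ 2 / Δ) := by ring
  linarith

end RepeatedPlay

end

theorem theorem5 :
    ∃ C : ℝ, 0 < C ∧
      ∀ (dx dy : ℕ) (G : BilinearGame dx dy) (T : ℕ), 2 ≤ T →
      ∀ (Ω : Type*) [MeasurableSpace Ω] (μ : Measure Ω) [IsProbabilityMeasure μ]
        (P : RepeatedPlay G μ),
        P.FollowsPureLinUCB 1 (PureLinUCB.radius (dx * dy) 1 (1 / (T : ℝ))) →
          P.psmr T ≤ C * (dx * dy * √(T : ℝ) * Real.log T) ∧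
          ∀ Δ : ℝ, G.IsGap Δ →
            P.psmr T ≤ C * (1 / Δ * (dx : ℝ) ^ 2 * (dy : ℝ) ^ 2 * Real.log T ^ 2) := by
  refine ⟨200, by norm_num, fun dx dy G T hT Ω _ μ _ P hP => ?_⟩
  -- If a dimension is zero the utility vanishes identically; the bounds on `log det` and on the
  -- radius need `d > 0`.
  rcases Nat.eq_zero_or_pos (dx * dy) with hd | hd
  · rw [P.psmr_eq_zero hd]
    have hL := PureLinUCB.le_log_of_two_le hT
    have hL0 : 0 ≤ Real.log T := by linarith
    refine ⟨by positivity, fun Δ hΔ => ?_⟩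
    have := hΔ.1
    positivity
  · exact ⟨P.psmr_le_sqrt hd hT hP, fun Δ hΔ => P.psmr_le_gap hd hT hP hΔ⟩
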